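/- Let $\mathbb F_q$ be a finite field, let $K_1,\dots,K_n$ be non-empty subsets of $\mathbb F_q$, $d_i=|K_i|$, and let $\mathcal X=K_1\times\cdots\times K_n$, $m=|\mathcal X|=\prod_{i=1}^n d_i$. Let $s\in\{1,\dots,n\}$, let $\delta$ be an integer with $2\le\delta\le d_s$, and put $r=d_s-\delta+1\ge 1$. For an integer $d\ge 0$ let $\mathcal D^{(\delta,s)}_{\mathcal X}(d)\subseteq\mathbb F_q^m$ be the code consisting of the vectors $(f(\alpha))_{\alpha\in\mathcal X}$, where $f$ runs over the polynomials in $\mathbb F_q[X_1,\dots,X_n]$ of total degree at most $d$ with $\deg_{X_s}f<d_s-\delta+1$, together with $f=0$. Put $$\tilde d=\sum_{i\ne s}(d_i-1)+d_s-\delta .$$ A linear code $\mathcal C\subseteq\mathbb F_q^m$ is called $(r,\delta)$-locally recoverable (for $r\ge1$, $\delta\ge2$, $r+\delta-1\le m$) if every position lies in a set $S$ of at most $r+\delta-1$ positions such that the code obtained from $\mathcal C$ by removing the entries outside $S$ has minimum distance at least $\delta$. Such a code, of dimension $k$, is called optimal if its minimum distance is equal to the bound of Prakash et al., $$m-k-\left(\left\lceil\frac{k}{r}\right\rceil-1\right)(\delta-1)+1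 .$$ Then: 1. $\mathcal D^{(\delta,s)}_{\mathcal X}(\tilde d)$ is an optimal $(r,\delta)$-locally recoverable code, and its minimum distance is $\delta$. 2. If $\tilde d\ge 1$ (which holds whenever $n\ge2$ and all $d_i\ge2$), then $\mathcal D^{(\delta,s)}_{\mathcal X}(\tilde d-1)$ is an optimal $(r,\delta)$-locally recoverable code, and if moreover $r\ge2$, that is, $\delta<d_s$, its minimum distance is $\delta+1$. -/

import Mathlib

namespace CartesianCode

/-- The minimum distance of a code `C ⊆ F^ι`: the least Hamming distance between two distinct
codewords. It is `⊤` for a code with only one codeword. -/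
noncomputable def minDist {F : Type*} [Field F] [DecidableEq F] {ι : Type*} [Fintype ι]
    (C : Submodule F (ι → F)) : ℕ∞ :=
  ⨅ (u : ι → F) (_ : u ∈ C) (v : ι → F) (_ : v ∈ C) (_ : u ≠ v), (hammingDist u v : ℕ∞)

/-- The punctured code obtained from `C` by removing the entries that are not in `S`. -/
def puncture {F : Type*} [Field F] {ι : Type*} (C : Submodule F (ι → F)) (S : Finset ι) :
    Submodule F (S → F) :=
  C.map (LinearMap.funLeft F F (Subtype.val : S → ι))

/-- `C` is `(r, δ)`-locally recoverable. -/
def IsLocallyRecoverable {F : Type*} [Field F] [DecidableEq F] {ι : Type*} [Fintype ι]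
    (C : Submodule F (ι → F)) (r δ : ℕ) : Prop :=
  1 ≤ r ∧ 2 ≤ δ ∧ r + δ - 1 ≤ Fintype.card ι ∧
    ∀ i : ι, ∃ S : Finset ι, i ∈ S ∧ S.card ≤ r + δ - 1 ∧ (δ : ℕ∞) ≤ minDist (puncture C S)

/-- The Prakash et al. upper bound for the minimum distance of an `(r, δ)`-locally recoverable
code of length `m` and dimension `k`: `m - k - (⌈k / r⌉ - 1) (δ - 1) + 1`. -/
def prakashBound (m k r δ : ℕ) : ℤ :=
  (m : ℤ) - k - (⌈(k : ℚ) / (r : ℚ)⌉ - 1) * ((δ : ℤ) - 1) + 1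

/-- `C` is an optimal `(r, δ)`-locally recoverable code: it is `(r, δ)`-locally recoverable
and its minimum distance is equal to the Prakash bound. -/
def IsOptimal {F : Type*} [Field F] [DecidableEq F] {ι : Type*} [Fintype ι]
    (C : Submodule F (ι → F)) (r δ : ℕ) : Prop :=
  IsLocallyRecoverable C r δ ∧
    ∃ w : ℕ, minDist C = (w : ℕ∞) ∧
      (w : ℤ) = prakashBound (Fintype.card ι) (Module.finrank F C) r δ

/-- The cartesian product `K₁ × ⋯ × Kₙ ⊆ Fⁿ`. -/
def cartesian {F : Type*} {n : ℕ} (K : Fin n → Finset F) : Finset (Fin n → F) :=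
  Fintype.piFinset K

/-- The evaluation morphism `f ↦ (f(α))_{α ∈ X}`; the positions of a codeword are
indexed by the points of `X` themselves. -/
noncomputable def evalMap {F : Type*} [Field F] {n : ℕ} (X : Finset (Fin n → F)) :
    MvPolynomial (Fin n) F →ₗ[F] (X → F) :=
  LinearMap.pi fun α => (MvPolynomial.aeval (α : Fin n → F)).toLinearMap

/-- The polynomials `f` of degree at most `d` such that the degree of `f` in the variable `X_s`
is less than `|K_s| - δ + 1` (an integer, possibly nonpositive), together with the zero
polynomial. -/
noncomputable def polySpace {F : Type*} [Field F] {n : ℕ} (K : Fin n → Finset F) (δ : ℕ)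
    (s : Fin n) (d : ℕ) : Submodule F (MvPolynomial (Fin n) F) where
  carrier := {f | f = 0 ∨
    (f.totalDegree ≤ d ∧ (f.degreeOf s : ℤ) < ((K s).card : ℤ) - (δ : ℤ) + 1)}
  zero_mem' := Or.inl rfl
  add_mem' := by
    rintro f g (rfl | ⟨hf, hf'⟩) (rfl | ⟨hg, hg'⟩)
    · exact Or.inl (add_zero 0)
    · rw [zero_add]
      exact Or.inr ⟨hg, hg'⟩
    · rw [add_zero]
      exact Or.inr ⟨hf, hf'⟩
    · refine Or.inr ⟨(MvPolynomial.totalDegree_add f g).trans (max_le hf hg), ?_⟩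
      have h := MvPolynomial.degreeOf_add_le s f g
      rcases le_max_iff.mp h with h | h <;> omega
  smul_mem' := by
    rintro c f (rfl | ⟨hf, hf'⟩)
    · exact Or.inl (smul_zero c)
    · refine Or.inr ⟨(MvPolynomial.totalDegree_smul_le c f).trans hf, ?_⟩
      have h := MvPolynomial.degreeOf_C_mul_le f s c
      rw [MvPolynomial.smul_eq_C_mul]
      omega

/-- The `(δ, s)`-quasi affine cartesian code of order `d` defined over `K₁, …, Kₙ`. -/
noncomputable def quasiAffineCode {F : Type*} [Field F] {n : ℕ} (K : Fin n → Finset F) (δ : ℕ)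
    (s : Fin n) (d : ℕ) : Submodule F (cartesian K → F) :=
  (polySpace K δ s d).map (evalMap (cartesian K))

/-- The number `∑_{i ≠ s} (|K_i| - 1) + |K_s| - δ`. No subtraction is truncated
when all `K_i` are nonempty and `δ ≤ |K_s|`. -/
def dTilde {F : Type*} {n : ℕ} (K : Fin n → Finset F) (δ : ℕ) (s : Fin n) : ℕ :=
  (∑ i ∈ Finset.univ.erase s, ((K i).card - 1)) + ((K s).card - δ)

end CartesianCode

namespace CartesianCode

open MvPolynomial Finset

/-! ### Minimum distance as minimum weight. -/

section MinDist

variable {F : Type*} [Field F] [DecidableEq F] {ι : Type*} [Fintype ι]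

/-! Let `M = ∏_{i≠s} d_i`. The grid splits into `M` lines in direction `s`, each with `d_s = r + δ -
1` points. On a line a codeword is a univariate polynomial of degree less than `r`, so it vanishes
or has at least `δ` nonzero entries; the lines are the recovery sets.

For order `dTilde`, `r` points per line determine a word, and the `rM` monomials below `topExponent`
are independent on the grid, so `k = rM`. A product of linear forms has weight `δ`, which is the
bound.

For order `dTilde - 1` only the top monomial is lost, so `k = rM - 1`. A word meeting two lines has
weight at least `2δ`. On a single line, weight at most `δ` is impossible: at most `δ - 1` linear
factors in `X_s` would isolate one grid point with degree below `∑ (d_i - 1)`, against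
`sum_card_sub_one_le_totalDegree`. The distance is thus `δ + 1` if `r ≥ 2`, and `2δ` if `r = 1`,
where a line has only `δ` points. Both match the bound. -/

theorem le_minDist {C : Submodule F (ι → F)} {w : ℕ}
    (h : ∀ c ∈ C, c ≠ 0 → w ≤ hammingNorm c) : (w : ℕ∞) ≤ minDist C := by
  refine le_iInf fun u => le_iInf fun hu => le_iInf fun v => le_iInf fun hv => le_iInf fun huv => ?_
  rw [hammingDist_eq_hammingNorm]
  exact_mod_cast h _ (C.add_mem (C.neg_mem hu) hv) fun h0 => huv (neg_add_eq_zero.mp h0)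

theorem minDist_le {C : Submodule F (ι → F)} {c : ι → F} (hc : c ∈ C) (h0 : c ≠ 0) :
    minDist C ≤ (hammingNorm c : ℕ∞) := by
  rw [← hammingDist_zero_right]
  exact iInf_le_of_le c <| iInf_le_of_le hc <| iInf_le_of_le 0 <| iInf_le_of_le C.zero_mem <|
    iInf_le_of_le h0 le_rfl

end MinDist

/-! ### The box of exponents of the monomial basis. -/

section TopExponent

variable {α : Type*} {n : ℕ} {K : Fin n → Finset α} {δ : ℕ} {s : Fin n}

/-- The exponent of the top monomial of the code of order `dTilde K δ s`. -/
noncomputable def topExponent {α : Type*} {n : ℕ} (K : Fin n → Finset α) (δ : ℕ) (s : Fin n) :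
    Fin n →₀ ℕ :=
  Finsupp.equivFunOnFinite.symm fun i => if i = s then #(K s) - δ else #(K i) - 1

@[simp]
theorem topExponent_self : topExponent K δ s s = #(K s) - δ := by
  simp [topExponent]

theorem topExponent_of_ne {i : Fin n} (hi : i ≠ s) : topExponent K δ s i = #(K i) - 1 := by
  simp [topExponent, hi]

theorem topExponent_lt (hK : ∀ i, (K i).Nonempty) (hδ : 1 ≤ δ) (i : Fin n) :
    topExponent K δ s i < #(K i) := by
  have := (hK i).card_pos
  rcases eq_or_ne i s with rfl | hi
  · rw [topExponent_self]
    omega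
  · rw [topExponent_of_ne hi]
    omega

theorem sum_topExponent : ∑ i, topExponent K δ s i = dTilde K δ s := by
  rw [← sum_erase_add univ _ (mem_univ s), dTilde, topExponent_self]
  congr 1
  exact sum_congr rfl fun i hi => topExponent_of_ne (ne_of_mem_erase hi)

theorem card_Iic_topExponent (hK : ∀ i, (K i).Nonempty) :
    #(Iic (topExponent K δ s)) = (#(K s) - δ + 1) * ∏ i ∈ univ.erase s, #(K i) := by
  rw [Finsupp.card_Iic, prod_subset (subset_univ _) fun i _ hi => by
    simp [Finsupp.notMem_support_iff.mp hi], ← mul_prod_erase univ _ (mem_univ s)]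
  congr 1
  · simp
  · refine prod_congr rfl fun i hi => ?_
    have := (hK i).card_pos
    rw [topExponent_of_ne (ne_of_mem_erase hi), Nat.card_Iic]
    omega

theorem prod_card_sub_topExponent (hK : ∀ i, (K i).Nonempty) (hs : δ ≤ #(K s)) :
    ∏ i, (#(K i) - topExponent K δ s i) = δ := by
  rw [← mul_prod_erase univ _ (mem_univ s), prod_eq_one, topExponent_self]
  · omega
  · intro i hi
    have := (hK i).card_pos
    rw [topExponent_of_ne (ne_of_mem_erase hi)]
    omega

end TopExponent

/-! ### Zeros of polynomials on lines and on the grid. -/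

variable {F : Type*} [Field F] {n : ℕ}

@[simp]
theorem evalMap_apply (X : Finset (Fin n → F)) (f : MvPolynomial (Fin n) F) (x : X) :
    evalMap X f x = eval (x : Fin n → F) f := by
  simp [evalMap, aeval_eq_eval]

theorem hammingNorm_evalMap [DecidableEq F] (X : Finset (Fin n → F))
    (f : MvPolynomial (Fin n) F) :
    hammingNorm (evalMap X f) = #{x ∈ X | eval x f ≠ 0} := by
  simp only [hammingNorm, evalMap_apply]
  rw [← card_map (Function.Embedding.subtype (· ∈ X))]
  congr 1
  ext x
  simp [and_comm]

/-- The restriction of a polynomial to a line in the direction of a coordinate. -/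
theorem exists_polynomial_on_line (f : MvPolynomial (Fin n) F) (x : Fin n → F) (s : Fin n) :
    ∃ h : Polynomial F, h.natDegree ≤ f.degreeOf s ∧
      ∀ a, h.eval a = eval (Function.update x s a) f := by
  refine ⟨∑ e ∈ f.support,
    Polynomial.C (f.coeff e * ∏ i ∈ univ.erase s, x i ^ e i) * Polynomial.X ^ e s, ?_, fun a => ?_⟩
  · exact Polynomial.natDegree_sum_le_of_forall_le _ _ fun e he =>
      (Polynomial.natDegree_C_mul_X_pow_le _ _).trans (monomial_le_degreeOf s he)
  · rw [Polynomial.eval_finsetSum, eval_eq']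
    refine sum_congr rfl fun e _ => ?_
    rw [← mul_prod_erase univ _ (mem_univ s)]
    have : ∏ i ∈ univ.erase s, Function.update x s a i ^ e i = ∏ i ∈ univ.erase s, x i ^ e i :=
      prod_congr rfl fun i hi => by rw [Function.update_of_ne (ne_of_mem_erase hi)]
    simp only [Polynomial.eval_mul, Polynomial.eval_C, Polynomial.eval_pow, Polynomial.eval_X,
      Function.update_self, this]
    ring

theorem card_le_degreeOf_add_card_ne_zero [DecidableEq F] (f : MvPolynomial (Fin n) F)
    (x : Fin n → F) (s : Fin n) (hx : eval x f ≠ 0) (A : Finset F) :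
    #A ≤ f.degreeOf s + #{a ∈ A | eval (Function.update x s a) f ≠ 0} := by
  obtain ⟨h, hdeg, hh⟩ := exists_polynomial_on_line f x s
  have h0 : h ≠ 0 := by
    rintro rfl
    apply hx
    simpa using (hh (x s)).symm
  rw [← card_filter_add_card_filter_not (s := A) (fun a => eval (Function.update x s a) f = 0)]
  gcongr
  refine le_trans (card_le_card ?_) ((Multiset.toFinset_card_le _).trans
    ((Polynomial.card_roots' h).trans hdeg))
  intro a ha
  rw [mem_filter] at ha
  simp [h0, hh, ha.2]

/-- The top coefficient functional on the grid `∏ K i` annihilates polynomials of small degree. -/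
theorem sum_eval_mul_weight_eq_zero [DecidableEq F] (K : Fin n → Finset F)
    (f : MvPolynomial (Fin n) F)
    (hf : f.totalDegree < ∑ i, (#(K i) - 1)) :
    ∑ x ∈ Fintype.piFinset K, eval x f * ∏ i, (∏ b ∈ (K i).erase (x i), (x i - b))⁻¹ = 0 := by
  simp_rw [eval_eq', sum_mul]
  rw [sum_comm]
  refine sum_eq_zero fun e he => ?_
  simp_rw [mul_assoc, ← prod_mul_distrib]
  rw [← mul_sum, ← prod_univ_sum K fun i a => a ^ e i * (∏ b ∈ (K i).erase a, (a - b))⁻¹]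
  obtain ⟨i, -, hi⟩ : ∃ i ∈ univ, e i < #(K i) - 1 := by
    apply exists_lt_of_sum_lt
    refine lt_of_le_of_lt ?_ hf
    simpa [Finsupp.sum_fintype] using le_totalDegree he
  rw [prod_eq_zero (mem_univ i), mul_zero]
  -- The `i`-th factor is the coefficient of degree `#(K i) - 1` in the Lagrange interpolation of `X
  -- ^ e i`, which is zero as `e i` is smaller.
  have := Lagrange.coeff_eq_sum (s := K i) (v := id) Function.injective_id.injOn
    (P := Polynomial.X ^ e i) (by
      rw [Polynomial.degree_X_pow]
      exact_mod_cast (by omega : e i < #(K i)))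
  rw [Polynomial.coeff_X_pow, if_neg (by omega)] at this
  simpa [div_eq_mul_inv] using this.symm

/-- In smaller degree the weighted sum over the grid would vanish, yet its only nonzero term is the
one at `x`. -/
theorem sum_card_sub_one_le_totalDegree [DecidableEq F] {K : Fin n → Finset F}
    {f : MvPolynomial (Fin n) F}
    {x : Fin n → F} (hx : x ∈ Fintype.piFinset K) (hfx : eval x f ≠ 0)
    (h : ∀ y ∈ Fintype.piFinset K, y ≠ x → eval y f = 0) :
    ∑ i, (#(K i) - 1) ≤ f.totalDegree := by
  by_contra! hlt
  have := sum_eval_mul_weight_eq_zero K f hlt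
  rw [sum_eq_single_of_mem x hx fun y hy hyx => by rw [h y hy hyx, zero_mul]] at this
  refine mul_ne_zero hfx (prod_ne_zero_iff.mpr fun i _ => inv_ne_zero ?_) this
  exact prod_ne_zero_iff.mpr fun b hb => sub_ne_zero.mpr (ne_of_mem_erase hb).symm

/-- The points of the line through `x` in direction `s` where `f` does not vanish. -/
theorem card_ne_zero_on_line [DecidableEq F] (K : Fin n → Finset F) (f : MvPolynomial (Fin n) F)
    {x : Fin n → F} (hx : x ∈ Fintype.piFinset K) (s : Fin n) :
    #{a ∈ K s | eval (Function.update x s a) f ≠ 0} =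
      #{y ∈ Fintype.piFinset K | eval y f ≠ 0 ∧ ∀ i ≠ s, y i = x i} := by
  refine card_bij (fun a _ => Function.update x s a) ?_ ?_ ?_
  · intro a ha
    rw [mem_filter] at ha
    rw [mem_filter, Fintype.mem_piFinset]
    refine ⟨fun i => ?_, ha.2, fun i hi => Function.update_of_ne hi _ _⟩
    rcases eq_or_ne i s with rfl | hi
    · simpa using ha.1
    · simpa [hi] using Fintype.mem_piFinset.mp hx i
  · intro a _ b _ hab
    exact Function.update_injective x s hab
  · intro y hy
    rw [mem_filter, Fintype.mem_piFinset] at hy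
    have : Function.update x s (y s) = y := by
      ext i
      rcases eq_or_ne i s with rfl | hi
      · simp
      · simp [hi, hy.2.2 i hi]
    exact ⟨y s, mem_filter.mpr ⟨hy.1 s, by rw [this]; exact hy.2.1⟩, this⟩

theorem sum_card_sub_one_eq {α : Type*} (K : Fin n → Finset α) (s : Fin n) {δ : ℕ} (hδ : 1 ≤ δ)
    (hs : δ ≤ #(K s)) : ∑ i, (#(K i) - 1) = dTilde K δ s + (δ - 1) := by
  rw [← sum_erase_add univ _ (mem_univ s), dTilde]
  omega

/-- A word of order less than `dTilde` supported on one line has weight more than `δ`. -/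
theorem lt_card_of_supported_on_line [DecidableEq F] {K : Fin n → Finset F} {s : Fin n} {δ : ℕ}
    (hδ : 1 ≤ δ) (hs : δ ≤ #(K s)) {f : MvPolynomial (Fin n) F} (hdeg : f.totalDegree < dTilde K δ s)
    {x : Fin n → F} (hx : x ∈ Fintype.piFinset K) (hfx : eval x f ≠ 0)
    (h : ∀ y ∈ Fintype.piFinset K, eval y f ≠ 0 → ∀ i ≠ s, y i = x i) :
    δ < #{a ∈ K s | eval (Function.update x s a) f ≠ 0} := by
  by_contra! hle
  set N := {a ∈ K s | eval (Function.update x s a) f ≠ 0} with hN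
  have hxN : x s ∈ N := by
    simp [hN, hfx, Fintype.mem_piFinset.mp hx s]
  -- The added factors kill every nonzero of `f` on the grid except `x`, at a cost of at most `δ -
  -- 1` in degree.
  set g : MvPolynomial (Fin n) F := f * ∏ a ∈ N.erase (x s), (X s - C a)
  have hg : g.totalDegree ≤ f.totalDegree + (#N - 1) := by
    refine (totalDegree_mul _ _).trans ?_
    gcongr
    refine (totalDegree_finsetProd _ _).trans ?_
    rw [← card_erase_of_mem hxN, card_eq_sum_ones]
    gcongr with a
    exact (totalDegree_sub_C_le _ _).trans (totalDegree_X s).le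
  have := sum_card_sub_one_le_totalDegree (f := g) hx ?_ ?_
  · rw [sum_card_sub_one_eq K s hδ hs] at this
    omega
  · simp only [g, map_mul, map_prod, map_sub, eval_X, eval_C]
    exact mul_ne_zero hfx (prod_ne_zero_iff.mpr fun b hb => sub_ne_zero.mpr (ne_of_mem_erase hb).symm)
  · intro y hy hyx
    simp only [g, map_mul, map_prod, map_sub, eval_X, eval_C]
    by_cases hfy : eval y f = 0
    · rw [hfy, zero_mul]
    have hline := h y hy hfy
    have hup : Function.update x s (y s) = y := by
      ext i
      rcases eq_or_ne i s with rfl | hi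
      · simp
      · simp [hi, hline i hi]
    have hys : y s ≠ x s := by
      intro h0
      rw [h0, Function.update_eq_self] at hup
      exact hyx hup.symm
    rw [prod_eq_zero (i := y s), mul_zero]
    · exact mem_erase.mpr ⟨hys, mem_filter.mpr ⟨Fintype.mem_piFinset.mp hy s, by rwa [hup]⟩⟩
    · exact sub_self _

/-- Either the nonzeros lie on one line, or two disjoint lines carry at least `δ` each. -/
theorem card_ne_zero_of_totalDegree_lt [DecidableEq F] {K : Fin n → Finset F} {s : Fin n} {δ : ℕ}
    (hδ : 1 ≤ δ) (hs : δ ≤ #(K s)) {f : MvPolynomial (Fin n) F} (hdeg : f.totalDegree < dTilde K δ s)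
    (hdegs : f.degreeOf s + δ ≤ #(K s)) {x : Fin n → F} (hx : x ∈ Fintype.piFinset K)
    (hfx : eval x f ≠ 0) :
    2 * δ ≤ #{y ∈ Fintype.piFinset K | eval y f ≠ 0} ∨
      δ < #(K s) ∧ δ < #{y ∈ Fintype.piFinset K | eval y f ≠ 0} := by
  by_cases h : ∀ y ∈ Fintype.piFinset K, eval y f ≠ 0 → ∀ i ≠ s, y i = x i
  · right
    have h1 := lt_card_of_supported_on_line hδ hs hdeg hx hfx h
    refine ⟨h1.trans_le (card_filter_le _ _), h1.trans_le ?_⟩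
    rw [card_ne_zero_on_line K f hx s]
    exact card_le_card fun y hy => by
      rw [mem_filter] at hy ⊢
      exact ⟨hy.1, hy.2.1⟩
  · left
    push Not at h
    obtain ⟨y, hy, hfy, i, his, hyx⟩ := h
    have h1 := card_le_degreeOf_add_card_ne_zero f x s hfx (K s)
    have h2 := card_le_degreeOf_add_card_ne_zero f y s hfy (K s)
    rw [card_ne_zero_on_line K f hx s] at h1
    rw [card_ne_zero_on_line K f hy s] at h2
    have hdisj : Disjoint {z ∈ Fintype.piFinset K | eval z f ≠ 0 ∧ ∀ i ≠ s, z i = x i}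
        {z ∈ Fintype.piFinset K | eval z f ≠ 0 ∧ ∀ i ≠ s, z i = y i} := by
      rw [disjoint_left]
      intro z hz hz'
      rw [mem_filter] at hz hz'
      exact hyx ((hz'.2.2 i his).symm.trans (hz.2.2 i his))
    have h3 : _ ≤ #{z ∈ Fintype.piFinset K | eval z f ≠ 0} :=
      card_le_card (union_subset
        (fun z hz => by rw [mem_filter] at hz ⊢; exact ⟨hz.1, hz.2.1⟩ :
          {z ∈ Fintype.piFinset K | eval z f ≠ 0 ∧ ∀ i ≠ s, z i = x i} ⊆ _)
        (fun z hz => by rw [mem_filter] at hz ⊢; exact ⟨hz.1, hz.2.1⟩ :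
          {z ∈ Fintype.piFinset K | eval z f ≠ 0 ∧ ∀ i ≠ s, z i = y i} ⊆ _))
    rw [card_union_of_disjoint hdisj] at h3
    omega

/-- The product of the linear forms vanishing at the hyperplanes `X_i = a`, `a ∈ T i`. -/
noncomputable def vanishingProduct (T : Fin n → Finset F) : MvPolynomial (Fin n) F :=
  ∏ i, ∏ a ∈ T i, (X i - C a)

theorem totalDegree_vanishingProduct (T : Fin n → Finset F) :
    (vanishingProduct T).totalDegree ≤ ∑ i, #(T i) := by
  refine (totalDegree_finsetProd _ _).trans (sum_le_sum fun i _ => ?_)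
  refine (totalDegree_finsetProd _ _).trans ?_
  rw [card_eq_sum_ones]
  gcongr with a
  exact (totalDegree_sub_C_le _ _).trans (totalDegree_X i).le

theorem degreeOf_vanishingProduct (T : Fin n → Finset F) (s : Fin n) :
    (vanishingProduct T).degreeOf s ≤ #(T s) := by
  have hlin : ∀ i a, degreeOf s (X i - C a : MvPolynomial (Fin n) F) ≤ if i = s then 1 else 0 := by
    intro i a
    refine (degreeOf_sub_le s _ _).trans ?_
    simp [degreeOf_X, degreeOf_C, eq_comm]
  refine (degreeOf_prod_le _ _ _).trans ?_
  calc _ ≤ ∑ i, if i = s then #(T i) else 0 := sum_le_sum fun i _ => by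
        refine (degreeOf_prod_le _ _ _).trans ((sum_le_sum fun a _ => hlin i a).trans ?_)
        split_ifs <;> simp
    _ = #(T s) := by simp

theorem card_eval_vanishingProduct_ne_zero [DecidableEq F] {K T : Fin n → Finset F}
    (hT : ∀ i, T i ⊆ K i) :
    #{x ∈ Fintype.piFinset K | eval x (vanishingProduct T) ≠ 0} = ∏ i, (#(K i) - #(T i)) := by
  have : {x ∈ Fintype.piFinset K | eval x (vanishingProduct T) ≠ 0} =
      Fintype.piFinset fun i => K i \ T i := by
    ext x
    simp only [vanishingProduct, mem_filter, Fintype.mem_piFinset, map_prod, map_sub, eval_X, eval_C,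
      mem_sdiff, prod_ne_zero_iff, sub_ne_zero, mem_univ, forall_true_left, forall_and]
    exact and_congr_right fun _ => forall_congr' fun i =>
      ⟨fun h hx => h _ hx rfl, fun h a ha hxa => h (hxa ▸ ha)⟩
  rw [this, Fintype.card_piFinset]
  exact prod_congr rfl fun i _ => card_sdiff_of_subset (hT i)

/-! ### Locality, dimension and distance of the codes. -/

section Code

variable {K : Fin n → Finset F} {δ : ℕ} {s : Fin n} {d : ℕ}

theorem evalMap_mem_quasiAffineCode {f : MvPolynomial (Fin n) F}
    (hd : f.totalDegree ≤ d) (hf : f.degreeOf s + δ ≤ #(K s)) :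
    evalMap (cartesian K) f ∈ quasiAffineCode K δ s d :=
  ⟨f, Or.inr ⟨hd, by omega⟩, rfl⟩

theorem exists_of_mem_quasiAffineCode (hs : δ ≤ #(K s)) {c : cartesian K → F}
    (hc : c ∈ quasiAffineCode K δ s d) :
    ∃ f : MvPolynomial (Fin n) F, f.totalDegree ≤ d ∧ f.degreeOf s + δ ≤ #(K s) ∧
      evalMap (cartesian K) f = c := by
  obtain ⟨f, rfl | ⟨h1, h2⟩, rfl⟩ := hc
  · exact ⟨0, by simp, by simpa using hs, rfl⟩
  · exact ⟨f, h1, by omega, rfl⟩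

theorem le_card_ne_zero_on_line [DecidableEq F] {f : MvPolynomial (Fin n) F}
    (hf : f.degreeOf s + δ ≤ #(K s)) {x : Fin n → F} (hx : x ∈ Fintype.piFinset K)
    (hfx : eval x f ≠ 0) :
    δ ≤ #{y ∈ Fintype.piFinset K | eval y f ≠ 0 ∧ ∀ i ≠ s, y i = x i} := by
  rw [← card_ne_zero_on_line K f hx s]
  have := card_le_degreeOf_add_card_ne_zero f x s hfx (K s)
  omega

theorem exists_eval_ne_zero {f : MvPolynomial (Fin n) F} (h : evalMap (cartesian K) f ≠ 0) :
    ∃ x ∈ Fintype.piFinset K, eval x f ≠ 0 := by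
  obtain ⟨x, hx⟩ := Function.ne_iff.mp h
  exact ⟨x, x.2, by simpa using hx⟩

theorem le_minDist_quasiAffineCode [DecidableEq F] (hs : δ ≤ #(K s)) :
    (δ : ℕ∞) ≤ minDist (quasiAffineCode K δ s d) := by
  refine le_minDist fun c hc h0 => ?_
  obtain ⟨f, -, hf, rfl⟩ := exists_of_mem_quasiAffineCode hs hc
  obtain ⟨x, hx, hfx⟩ := exists_eval_ne_zero h0
  rw [hammingNorm_evalMap]
  refine (le_card_ne_zero_on_line hf hx hfx).trans (card_le_card fun y hy => ?_)
  rw [mem_filter] at hy ⊢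
  exact ⟨hy.1, hy.2.1⟩

theorem card_cartesian {α : Type*} (K : Fin n → Finset α) (s : Fin n) :
    Fintype.card (cartesian K) = #(K s) * ∏ i ∈ univ.erase s, #(K i) := by
  rw [Fintype.card_coe, cartesian, Fintype.card_piFinset,
    mul_prod_erase univ (fun i => #(K i)) (mem_univ s)]

theorem isLocallyRecoverable_quasiAffineCode [DecidableEq F] (hK : ∀ i, (K i).Nonempty)
    (hδ : 2 ≤ δ) (hs : δ ≤ #(K s)) :
    IsLocallyRecoverable (quasiAffineCode K δ s d) (#(K s) - δ + 1) δ := by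
  refine ⟨by omega, hδ, ?_, fun x => ?_⟩
  · rw [card_cartesian K s]
    have : 0 < ∏ i ∈ univ.erase s, #(K i) := prod_pos fun i _ => (hK i).card_pos
    have := Nat.le_mul_of_pos_right (#(K s)) this
    omega
  · refine ⟨({y | ∀ i ≠ s, y.1 i = x.1 i} : Finset (cartesian K)), by simp, ?_, ?_⟩
    · rw [show #(K s) - δ + 1 + δ - 1 = #(K s) by omega]
      refine card_le_card_of_injOn (fun y => y.1 s)
        (fun y _ => Fintype.mem_piFinset.mp y.2 s) fun y hy z hz hyz => ?_
      rw [mem_coe, mem_filter] at hy hz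
      ext i
      rcases eq_or_ne i s with rfl | hi
      · exact hyz
      · rw [hy.2 i hi, hz.2 i hi]
    · refine le_minDist fun c hc h0 => ?_
      obtain ⟨c, hc, rfl⟩ := hc
      obtain ⟨f, -, hf, rfl⟩ := exists_of_mem_quasiAffineCode hs hc
      obtain ⟨y, hy⟩ := Function.ne_iff.mp h0
      simp only [LinearMap.funLeft_apply, evalMap_apply, Pi.zero_apply] at hy
      have hyx := (mem_filter.mp y.2).2
      refine (le_card_ne_zero_on_line hf y.1.2 hy).trans ?_
      rw [hammingNorm, ← card_map ((Function.Embedding.subtype _).trans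
        (Function.Embedding.subtype (· ∈ cartesian K)))]
      refine card_le_card fun z hz => ?_
      rw [mem_filter] at hz
      rw [mem_map]
      refine ⟨⟨⟨z, hz.1⟩, mem_filter.mpr ⟨mem_univ _, fun i hi => ?_⟩⟩, ?_, rfl⟩
      · exact (hz.2.2 i hi).trans (hyx i hi)
      · exact mem_filter.mpr ⟨mem_univ _, by
          rw [LinearMap.funLeft_apply, evalMap_apply]; exact hz.2.1⟩

/-- A polynomial of degree below `#(K i)` in each variable that vanishes on the grid is zero, so
evaluation is injective on the span of these monomials. -/
theorem card_le_finrank_quasiAffineCode (hK : ∀ i, (K i).Nonempty) (hs : δ ≤ #(K s))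
    (A : Finset (Fin n →₀ ℕ))
    (hA : ∀ e ∈ A, (∀ i, e i < #(K i)) ∧ e s + δ ≤ #(K s) ∧ e.degree ≤ d) :
    #A ≤ Module.finrank F (quasiAffineCode K δ s d) := by
  let V := restrictSupport F (A : Set (Fin n →₀ ℕ))
  have hV : Module.finrank F V = #A := by
    rw [Module.finrank_eq_card_basis (basisRestrictSupport F (A : Set (Fin n →₀ ℕ)))]
    simp
  let φ := (evalMap (cartesian K)).domRestrict V
  have hinj : Function.Injective φ := by
    rw [← LinearMap.ker_eq_bot, LinearMap.ker_eq_bot']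
    rintro ⟨f, hf⟩ h0
    ext1
    refine eq_zero_of_eval_zero_at_prod_finset f K (fun i => ?_) fun x hx => ?_
    · rw [degreeOf_lt_iff (hK i).card_pos]
      exact fun e he => (hA e (hf he)).1 i
    · simpa [φ] using congrFun h0 ⟨x, Fintype.mem_piFinset.mpr hx⟩
  rw [← hV, ← LinearMap.finrank_range_of_inj hinj]
  refine Submodule.finrank_mono ?_
  rintro _ ⟨⟨f, hf⟩, rfl⟩
  refine evalMap_mem_quasiAffineCode ?_ ?_
  · exact Finset.sup_le fun e he => (hA e (hf he)).2.2
  · have : f.degreeOf s ≤ #(K s) - δ :=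
      degreeOf_le_iff.mpr fun e he => Nat.le_sub_of_add_le (hA e (hf he)).2.1
    exact Nat.add_le_of_le_sub hs this

theorem finrank_quasiAffineCode_le (hs : δ ≤ #(K s)) :
    Module.finrank F (quasiAffineCode K δ s d) ≤
      (#(K s) - δ + 1) * ∏ i ∈ univ.erase s, #(K i) := by
  classical
  -- For `δ = 0` no subset `T` of the required size exists, but the length already bounds the
  -- dimension.
  rcases δ.eq_zero_or_pos with rfl | hδ
  · refine (Submodule.finrank_le _).trans ?_
    rw [Module.finrank_fintype_fun_eq_card, card_cartesian K s]
    gcongr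
    omega
  obtain ⟨T, hTK, hT⟩ := exists_subset_card_eq (s := K s) (n := #(K s) - δ + 1) (by omega)
  -- Keep `r` points on each line: more than the degree in `X_s`, so no nonzero word vanishes on all
  -- of them.
  set K' := Function.update K s T with hK'
  have hsub : ∀ x ∈ Fintype.piFinset K', x ∈ cartesian K := fun x hx => by
    rw [cartesian, Fintype.mem_piFinset]
    intro i
    have := Fintype.mem_piFinset.mp hx i
    rcases eq_or_ne i s with rfl | hi
    · exact hTK (by simpa [hK'] using this)
    · simpa [hK', hi] using this
  let ρ : Fintype.piFinset K' → cartesian K := fun x => ⟨x, hsub x x.2⟩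
  have hinj : Function.Injective ((LinearMap.funLeft F F ρ).domRestrict (quasiAffineCode K δ s d)) := by
    rw [← LinearMap.ker_eq_bot, LinearMap.ker_eq_bot']
    rintro ⟨c, hc⟩ h0
    obtain ⟨f, -, hf, rfl⟩ := exists_of_mem_quasiAffineCode hs hc
    by_contra hne
    obtain ⟨x, hx, hfx⟩ := exists_eval_ne_zero fun h => hne (Subtype.ext h)
    have h1 := card_le_degreeOf_add_card_ne_zero f x s hfx T
    rw [filter_eq_empty_iff.mpr, card_empty] at h1
    · omega
    · intro a ha
      have hmem : Function.update x s a ∈ Fintype.piFinset K' := by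
        rw [Fintype.mem_piFinset]
        intro i
        rcases eq_or_ne i s with rfl | hi
        · simpa [hK'] using ha
        · simpa [hK', hi] using Fintype.mem_piFinset.mp hx i
      simpa [ρ, LinearMap.funLeft_apply] using congrFun h0 ⟨_, hmem⟩
  refine (LinearMap.finrank_le_finrank_of_injective hinj).trans ?_
  rw [Module.finrank_fintype_fun_eq_card, Fintype.card_coe, Fintype.card_piFinset,
    ← mul_prod_erase univ _ (mem_univ s)]
  refine Nat.mul_le_mul (by simp [hK', hT]) (prod_le_prod' fun i hi => ?_)
  simp [hK', ne_of_mem_erase hi]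

theorem exists_hammingNorm_eq_prod [DecidableEq F] (t : Fin n → ℕ)
    (ht : ∀ i, t i < #(K i)) (hts : t s + δ ≤ #(K s)) (hd : ∑ i, t i ≤ d) :
    ∃ c ∈ quasiAffineCode K δ s d, c ≠ 0 ∧ hammingNorm c = ∏ i, (#(K i) - t i) := by
  choose T hTK hT using fun i => exists_subset_card_eq (ht i).le
  have hnorm : hammingNorm (evalMap (cartesian K) (vanishingProduct T)) = ∏ i, (#(K i) - t i) := by
    rw [hammingNorm_evalMap, cartesian, card_eval_vanishingProduct_ne_zero hTK]
    simp_rw [hT]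
  refine ⟨_, evalMap_mem_quasiAffineCode ((totalDegree_vanishingProduct T).trans ?_) ?_, ?_, hnorm⟩
  · simpa [hT] using hd
  · have := degreeOf_vanishingProduct T s
    rw [hT] at this
    omega
  · rw [← hammingNorm_ne_zero_iff, hnorm]
    exact prod_ne_zero_iff.mpr fun i _ => (Nat.sub_pos_of_lt (ht i)).ne'

theorem finrank_quasiAffineCode_dTilde (hK : ∀ i, (K i).Nonempty) (hδ : 1 ≤ δ) (hs : δ ≤ #(K s)) :
    Module.finrank F (quasiAffineCode K δ s (dTilde K δ s)) =
      (#(K s) - δ + 1) * ∏ i ∈ univ.erase s, #(K i) := by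
  refine (finrank_quasiAffineCode_le hs).antisymm ?_
  rw [← card_Iic_topExponent hK]
  refine card_le_finrank_quasiAffineCode hK hs _ fun e he => ?_
  rw [mem_Iic] at he
  refine ⟨fun i => (he i).trans_lt (topExponent_lt hK hδ i), ?_, ?_⟩
  · have := he s
    rw [topExponent_self] at this
    omega
  · rw [← sum_topExponent, ← Finsupp.degree_eq_sum]
    exact Finsupp.degree_mono he

theorem minDist_quasiAffineCode_dTilde [DecidableEq F] (hK : ∀ i, (K i).Nonempty) (hδ : 1 ≤ δ)
    (hs : δ ≤ #(K s)) : minDist (quasiAffineCode K δ s (dTilde K δ s)) = δ := by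
  refine le_antisymm ?_ (le_minDist_quasiAffineCode hs)
  obtain ⟨c, hc, h0, hnorm⟩ := exists_hammingNorm_eq_prod (s := s) (δ := δ) (d := dTilde K δ s)
    (topExponent K δ s) (topExponent_lt hK hδ) (by rw [topExponent_self]; omega)
    sum_topExponent.le
  rw [prod_card_sub_topExponent hK hs] at hnorm
  exact (minDist_le hc h0).trans (by rw [hnorm])

theorem le_minDist_quasiAffineCode_dTilde_sub_one [DecidableEq F] (hδ : 1 ≤ δ) (hs : δ ≤ #(K s))
    (hd : 1 ≤ dTilde K δ s) :
    ((if δ < #(K s) then δ + 1 else 2 * δ : ℕ) : ℕ∞) ≤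
      minDist (quasiAffineCode K δ s (dTilde K δ s - 1)) := by
  refine le_minDist fun c hc h0 => ?_
  obtain ⟨f, hdeg, hf, rfl⟩ := exists_of_mem_quasiAffineCode hs hc
  obtain ⟨x, hx, hfx⟩ := exists_eval_ne_zero h0
  rw [hammingNorm_evalMap, cartesian]
  have := card_ne_zero_of_totalDegree_lt hδ hs (by omega) hf hx hfx
  split_ifs <;> omega

theorem minDist_quasiAffineCode_dTilde_sub_one [DecidableEq F] (hK : ∀ i, (K i).Nonempty)
    (hδ : 1 ≤ δ) (hs : δ ≤ #(K s)) (hd : 1 ≤ dTilde K δ s) :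
    minDist (quasiAffineCode K δ s (dTilde K δ s - 1)) =
      (if δ < #(K s) then δ + 1 else 2 * δ : ℕ) := by
  refine le_antisymm ?_ (le_minDist_quasiAffineCode_dTilde_sub_one hδ hs hd)
  -- Lowering one positive entry of the top exponent saves one degree. Taking `j = s` turns the
  -- factor `δ` into `δ + 1`; if `δ = #(K s)` that entry is zero, and another `j` turns a factor `1`
  -- into `2`.
  obtain ⟨j, hj, hval⟩ : ∃ j, 1 ≤ topExponent K δ s j ∧
      (#(K j) - topExponent K δ s j + 1) *
        ∏ i ∈ univ.erase j, (#(K i) - topExponent K δ s i) =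
      if δ < #(K s) then δ + 1 else 2 * δ := by
    have hprod := prod_card_sub_topExponent hK hs
    split_ifs with hlt
    · refine ⟨s, by rw [topExponent_self]; omega, ?_⟩
      rw [prod_eq_one, topExponent_self]
      · omega
      · intro i hi
        have := (hK i).card_pos
        rw [topExponent_of_ne (ne_of_mem_erase hi)]
        omega
    · obtain ⟨j, -, hj⟩ : ∃ j ∈ univ, topExponent K δ s j ≠ 0 := by
        refine exists_ne_zero_of_sum_ne_zero ?_
        rw [sum_topExponent]
        omega
      have hjs : j ≠ s := by
        rintro rfl
        rw [topExponent_self] at hj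
        omega
      refine ⟨j, by omega, ?_⟩
      have := (hK j).card_pos
      rw [← mul_prod_erase univ _ (mem_univ j)] at hprod
      rw [topExponent_of_ne hjs, show #(K j) - (#(K j) - 1) = 1 by omega] at hprod ⊢
      rw [one_mul] at hprod
      rw [hprod]
  have hle : ∀ i, Function.update (topExponent K δ s) j (topExponent K δ s j - 1) i ≤
      topExponent K δ s i := by
    intro i
    rcases eq_or_ne i j with rfl | hi
    · simp
    · simp [hi]
  obtain ⟨c, hc, h0, hnorm⟩ := exists_hammingNorm_eq_prod (s := s) (δ := δ)
    (d := dTilde K δ s - 1)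
    (Function.update (topExponent K δ s) j (topExponent K δ s j - 1))
    (fun i => (hle i).trans_lt (topExponent_lt hK hδ i))
    (by have := hle s; rw [topExponent_self] at this; omega)
    (by
      rw [sum_update_of_mem (mem_univ j), sdiff_singleton_eq_erase, ← sum_topExponent,
        ← add_sum_erase univ _ (mem_univ j)]
      omega)
  rw [← mul_prod_erase univ _ (mem_univ j), Function.update_self,
    prod_congr rfl fun i hi => by rw [Function.update_of_ne (ne_of_mem_erase hi)],
    show #(K j) - (topExponent K δ s j - 1) = #(K j) - topExponent K δ s j + 1 by
      have := topExponent_lt (s := s) hK hδ j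
      omega, hval] at hnorm
  exact (minDist_le hc h0).trans (by rw [hnorm])

theorem finrank_quasiAffineCode_dTilde_sub_one (hK : ∀ i, (K i).Nonempty) (hδ : 2 ≤ δ)
    (hs : δ ≤ #(K s)) (hd : 1 ≤ dTilde K δ s) :
    Module.finrank F (quasiAffineCode K δ s (dTilde K δ s - 1)) + 1 =
      (#(K s) - δ + 1) * ∏ i ∈ univ.erase s, #(K i) := by
  classical
  refine le_antisymm ?_ ?_
  · rw [← finrank_quasiAffineCode_dTilde hK (by omega) hs]
    refine Submodule.finrank_lt_finrank_of_lt (lt_of_le_of_ne ?_ fun h => ?_)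
    · intro c hc
      obtain ⟨f, hdeg, hf, rfl⟩ := exists_of_mem_quasiAffineCode hs hc
      exact evalMap_mem_quasiAffineCode (by omega) hf
    -- The inclusion is strict because the minimum distances differ.
    · have h1 := minDist_quasiAffineCode_dTilde_sub_one hK (by omega) hs hd
      rw [h, minDist_quasiAffineCode_dTilde hK (by omega) hs, Nat.cast_inj] at h1
      split_ifs at h1 <;> omega
  · have hcard := card_Iic_topExponent (δ := δ) (s := s) hK
    rw [← hcard, ← Iio_insert, card_insert_of_notMem (by simp)]
    gcongr
    refine card_le_finrank_quasiAffineCode hK hs _ fun e he => ?_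
    rw [mem_Iio] at he
    refine ⟨fun i => (he.le i).trans_lt (topExponent_lt hK (by omega) i), ?_, ?_⟩
    · have := he.le s
      rw [topExponent_self] at this
      omega
    · obtain ⟨hle, i, hi⟩ := Finsupp.lt_def.mp he
      rw [← sum_topExponent, Finsupp.degree_eq_sum]
      exact Nat.le_sub_one_of_lt (sum_lt_sum (fun i _ => hle i) ⟨i, mem_univ i, hi⟩)

end Code

/-! ### Values of the Prakash bound. -/

theorem prakashBound_mul {r δ M : ℕ} (hr : 1 ≤ r) :
    prakashBound ((r + δ - 1) * M) (r * M) r δ = δ := by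
  have hr' : (r : ℚ) ≠ 0 := by positivity
  have hc : ⌈((r * M : ℕ) : ℚ) / (r : ℚ)⌉ = M := by
    rw [Nat.cast_mul, mul_div_cancel_left₀ _ hr', Int.ceil_natCast]
  rw [prakashBound, hc]
  push_cast [Nat.cast_sub (show 1 ≤ r + δ by omega)]
  ring

theorem prakashBound_of_two_le {r δ M k : ℕ} (hr : 2 ≤ r) (hk : k + 1 = r * M) :
    prakashBound ((r + δ - 1) * M) k r δ = δ + 1 := by
  have hr' : (0 : ℚ) < r := by positivity
  have hkq : (k : ℚ) + 1 = r * M := by exact_mod_cast hk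
  have hr2 : (2 : ℚ) ≤ r := by exact_mod_cast hr
  -- Here `k / r = M - 1 / r`, which exceeds `M - 1` exactly because `r > 1`.
  have hc : ⌈(k : ℚ) / (r : ℚ)⌉ = M := by
    rw [Int.ceil_eq_iff, lt_div_iff₀ hr', div_le_iff₀ hr']
    push_cast
    constructor <;> linarith
  have hkz : (k : ℤ) = r * M - 1 := by
    rw [eq_sub_iff_add_eq]
    exact_mod_cast hk
  rw [prakashBound, hc, hkz]
  push_cast [Nat.cast_sub (show 1 ≤ r + δ by omega)]
  ring

theorem prakashBound_one {δ M k : ℕ} (hk : k + 1 = M) :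
    prakashBound (δ * M) k 1 δ = 2 * δ := by
  subst hk
  have hc : ⌈(k : ℚ) / ((1 : ℕ) : ℚ)⌉ = k := by simp
  rw [prakashBound, hc]
  push_cast
  ring

end CartesianCode

/-- Here `|K s| - δ + 1` is the locality parameter `r`. The hypothesis `1 ≤ dTilde K δ s` only
says that the order `dTilde K δ s - 1` is nonnegative. -/
theorem corollary4p2 {F : Type*} [Field F] [Fintype F] [DecidableEq F] {n : ℕ}
    (K : Fin n → Finset F) (hK : ∀ i, (K i).Nonempty) (s : Fin n) (δ : ℕ)
    (hδ : 2 ≤ δ) (hs : δ ≤ (K s).card) :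
    (CartesianCode.IsOptimal
        (CartesianCode.quasiAffineCode K δ s (CartesianCode.dTilde K δ s))
        ((K s).card - δ + 1) δ ∧
      CartesianCode.minDist
        (CartesianCode.quasiAffineCode K δ s (CartesianCode.dTilde K δ s)) = (δ : ℕ∞)) ∧
    (1 ≤ CartesianCode.dTilde K δ s →
      CartesianCode.IsOptimal
        (CartesianCode.quasiAffineCode K δ s (CartesianCode.dTilde K δ s - 1))
        ((K s).card - δ + 1) δ ∧
      (δ < (K s).card →
        CartesianCode.minDist
          (CartesianCode.quasiAffineCode K δ s (CartesianCode.dTilde K δ s - 1)) =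
            ((δ + 1 : ℕ) : ℕ∞))) := by
  have hdist := CartesianCode.minDist_quasiAffineCode_dTilde hK (by omega) hs
  refine ⟨⟨⟨CartesianCode.isLocallyRecoverable_quasiAffineCode hK hδ hs, δ, hdist, ?_⟩, hdist⟩,
    fun hd => ?_⟩
  · rw [CartesianCode.finrank_quasiAffineCode_dTilde hK (by omega) hs,
      CartesianCode.card_cartesian K s]
    conv_rhs => rw [show (K s).card * _ = ((K s).card - δ + 1 + δ - 1) * _ from
      congrArg (· * _) (by omega)]
    exact (CartesianCode.prakashBound_mul (by omega)).symm
  · have hdist := CartesianCode.minDist_quasiAffineCode_dTilde_sub_one hK (by omega) hs hd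
    have hk := CartesianCode.finrank_quasiAffineCode_dTilde_sub_one hK hδ hs hd
    refine ⟨⟨CartesianCode.isLocallyRecoverable_quasiAffineCode hK hδ hs, _, hdist, ?_⟩,
      fun hlt => by rw [hdist, if_pos hlt]⟩
    rw [CartesianCode.card_cartesian K s]
    split_ifs with hlt
    · have := CartesianCode.prakashBound_of_two_le (δ := δ) (by omega) hk
      rw [show (K s).card - δ + 1 + δ - 1 = (K s).card by omega] at this
      rw [this]
      push_cast
      rfl
    · obtain rfl : δ = (K s).card := by omega
      rw [Nat.sub_self, zero_add, one_mul] at hk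
      rw [Nat.sub_self, zero_add, CartesianCode.prakashBound_one hk]
      push_cast
      rfl
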